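/- Let $(k,|\cdot|)$ be a complete non-archimedean valued field of characteristic $0$ (the trivial absolute value is allowed), with residue field $\widetilde k=k^\circ/k^{\circ\circ}$, and with $|\cdot|$ normalized by $|p|=p^{-1}$ if $\operatorname{char}\widetilde k=p>0$. Put $R(k)=1$ if $\operatorname{char}\widetilde k=0$ and $R(k)=p^{-1/(p-1)}$ if $\operatorname{char}\widetilde k=p>0$. Let $A$ be a $k$-affinoid algebra (in the sense of Berkovich, not necessarily strict or reduced) with a Banach algebra norm $\|\cdot\|$ defining its structure, let $f:\mathcal M(A)\to\mathcal M(A)$ be the endomorphism of the $k$-affinoid space $\mathcal M(A)$ induced by a bounded $k$-algebra endomorphism $f^*:A\to A$, let $\Delta_f=f^*-\mathrm{id}$, a bounded $k$-linear operator on $A$, and let $\rho(\Delta_f)=\lim_{n\to\infty}\|\Delta_f^n\|^{1/n}$ be its spectral radius, where $\|\Delta_f^n\|$ is the operator norm with respect to $\|\cdot\|$. If $\rho(\Delta_f)<R(k)$ and $f^l=\mathrm{id}$ (as an endomorphism of the $k$-affinoid space, that is, $(f^*)^l=\mathrm{id}$) for some integer $l\ge 1$, then $f=\mathrm{id}$ (that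 is, $f^*=\mathrm{id}$). -/

import Mathlib

namespace Affinoid

/-- The algebra `k{r₁⁻¹T₁, …, rₙ⁻¹Tₙ}` of power series `∑ a_ν T^ν` over `k` such that
`|a_ν| r^ν → 0`, as a subalgebra of the algebra of all power series. -/
noncomputable def tateAlgebra (k : Type*) [NormedField k] [IsUltrametricDist k] {n : ℕ}
    (r : Fin n → ℝ) : Subalgebra k (MvPowerSeries (Fin n) k) where
  __ := MvPowerSeries.IsRestricted.subring (R := k) r
  algebraMap_mem' a := MvPowerSeries.isRestricted_C r a

/-- The Gauss norm `max_ν |a_ν| r^ν` on `k{r₁⁻¹T₁, …, rₙ⁻¹Tₙ}`. -/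
noncomputable def tateNorm {k : Type*} [NormedField k] [IsUltrametricDist k] {n : ℕ}
    {r : Fin n → ℝ} (g : tateAlgebra k r) : ℝ :=
  MvPowerSeries.gaussNorm (fun a : k => ‖a‖) r (g : MvPowerSeries (Fin n) k)

/-- A commutative Banach `k`-algebra `A` is `k`-affinoid if there is an admissible epimorphism
`φ : k{r₁⁻¹T₁, …, rₙ⁻¹Tₙ} → A` for some `n ≥ 0` and some real `rᵢ > 0`: a surjective homomorphism
of `k`-algebras such that the norm of `A` is equivalent to the quotient norm. -/
def IsAffinoidAlgebra (k A : Type*) [NormedField k] [IsUltrametricDist k] [NormedCommRing A]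
    [NormedAlgebra k A] [CompleteSpace A] : Prop :=
  ∃ (n : ℕ) (r : Fin n → ℝ), (∀ i, 0 < r i) ∧
    ∃ φ : tateAlgebra k r →ₐ[k] A, ∃ C : ℝ,
      (∀ g, ‖φ g‖ ≤ C * tateNorm g) ∧ ∀ a : A, ∃ g, φ g = a ∧ tateNorm g ≤ C * ‖a‖

/-- The Berkovich spectrum `ℳ(A)`: the set of bounded multiplicative seminorms on `A`. -/
@[ext]
structure Spectrum (A : Type*) [NormedCommRing A] where
  /-- The multiplicative seminorm `a ↦ |a(x)|` given by a point `x`. -/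
  seminorm : MulRingSeminorm A
  bounded : ∃ C : ℝ, ∀ a, seminorm a ≤ C * ‖a‖

/-- An endomorphism of the `k`-affinoid space `ℳ(A)`: a self-map `f` of `ℳ(A)` induced by a
bounded `k`-algebra endomorphism `f^*` of `A`, which is part of the datum (the category of
`k`-affinoid spaces is dual to that of `k`-affinoid algebras and bounded homomorphisms). -/
@[ext]
structure Endomorphism (k A : Type*) [NormedField k] [NormedCommRing A] [NormedAlgebra k A] where
  /-- The map on points. -/
  toFun : Spectrum A → Spectrum A
  /-- The endomorphism `f^*` of `A`. -/
  comorphism : A →ₐ[k] A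
  bounded : ∃ C : ℝ, ∀ a, ‖comorphism a‖ ≤ C * ‖a‖
  seminorm_toFun : ∀ x a, (toFun x).seminorm a = x.seminorm (comorphism a)

namespace Endomorphism

variable {k A : Type*} [NormedField k] [NormedCommRing A] [NormedAlgebra k A]

/-- The identity of `ℳ(A)`. -/
instance : One (Endomorphism k A) where
  one :=
    { toFun := id
      comorphism := AlgHom.id k A
      bounded := ⟨1, fun a => by simp⟩
      seminorm_toFun := fun _ _ => rfl }

/-- Composition `f ∘ g` of endomorphisms of `ℳ(A)`, with `(f ∘ g)^* = g^* ∘ f^*`. -/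
instance : Mul (Endomorphism k A) where
  mul f g :=
    { toFun := f.toFun ∘ g.toFun
      comorphism := g.comorphism.comp f.comorphism
      bounded := by
        obtain ⟨C, hC⟩ := f.bounded
        obtain ⟨D, hD⟩ := g.bounded
        refine ⟨|D| * C, fun a => ?_⟩
        calc ‖g.comorphism (f.comorphism a)‖ ≤ D * ‖f.comorphism a‖ := hD _
          _ ≤ |D| * ‖f.comorphism a‖ := by gcongr; exact le_abs_self D
          _ ≤ |D| * (C * ‖a‖) := by gcongr; exact hC a
          _ = |D| * C * ‖a‖ := by ring
      seminorm_toFun := fun x a => by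
        simp [f.seminorm_toFun, g.seminorm_toFun] }

/-- Endomorphisms of `ℳ(A)` under composition; `f ^ n` is the `n`-th iterate of `f`. -/
instance : Monoid (Endomorphism k A) where
  mul_assoc _ _ _ := rfl
  one_mul _ := rfl
  mul_one _ := rfl

/-- The difference operator `Δ_f = f^* - id` on `A`. -/
def difference (f : Endomorphism k A) : Module.End k A :=
  f.comorphism.toLinearMap - LinearMap.id

end Endomorphism

/-- The operator norm of a bounded `k`-linear operator on `A`. -/
noncomputable def operatorNorm {k A : Type*} [NormedField k] [NormedCommRing A] [NormedAlgebra k A]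
    (T : Module.End k A) : ℝ :=
  sInf {c : ℝ | 0 ≤ c ∧ ∀ a, ‖T a‖ ≤ c * ‖a‖}

/-- The spectral radius `lim_n ‖T^n‖^(1/n) = inf_{n ≥ 1} ‖T^n‖^(1/n)` of a bounded `k`-linear
operator on `A`. -/
noncomputable def operatorSpectralRadius {k A : Type*} [NormedField k] [NormedCommRing A]
    [NormedAlgebra k A] (T : Module.End k A) : ℝ :=
  ⨅ n : ℕ+, operatorNorm (T ^ (n : ℕ)) ^ (1 / (n : ℝ))

/-- The residue field `k°/k°°` of a non-archimedean field `k`. -/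
abbrev ResidueField (k : Type*) [NormedField k] [IsUltrametricDist k] : Type _ :=
  IsLocalRing.ResidueField (NormedField.valuation (K := k)).valuationSubring

/-- The constant `R(k)`: it is `1` if the residue field has characteristic `0`, and
`p^(-1/(p-1))` if it has characteristic `p > 0`. -/
noncomputable def radius (k : Type*) [NormedField k] [IsUltrametricDist k] : ℝ :=
  if ringChar (ResidueField k) = 0 then 1
  else (ringChar (ResidueField k) : ℝ) ^ (-(1 / ((ringChar (ResidueField k) : ℝ) - 1)))

end Affinoid

/-!
Write `N = f^* - 1`, `R = R(k)`, and let `l ≥ 1` satisfy `(1 + N)^l = 1`. Dividing the binomial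
expansion by `l` gives
`N = -∑_{j ≥ 2} (l choose j) / l • N^j`, where `(l choose j) / l = (l - 1 choose j - 1) / j`.
Integers have norm at most `1`, and `R^(j-1) ≤ |j|` because `p^v ∣ j` forces `v (p - 1) ≤ j - 1`
(`Affinoid.radius_pow_le_norm_natCast`). Hence the `j`-th coefficient has norm at most `R^(-(j-1))`.

The norm of an affinoid algebra is equivalent to an ultrametric one, the quotient norm `ν` of an
admissible epimorphism (`Affinoid.IsAffinoidAlgebra.exists_ultrametric`). Put
`b n = ν (N^n a) / R^n`. The ultrametric inequality applied to the identity above, multiplied by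
`N^(n-1)`, shows that each `b n` with `n ≥ 1` is bounded by some later `b m`. As `ρ(N) < R`, the sequence `b` tends to `0`, so `b n` vanishes for `n ≥ 1`
(`Affinoid.nonpos_of_le_later`). In particular `N a = 0` for all `a`, that is `f^* = 1`. The map
on points is determined by `f^*`. No reduction to prime `l`, and no eigenvalues, are needed.
-/

namespace Affinoid

open Filter Topology

/-! ### The radius `R(k)` and norms of integers -/

section Radius

variable {k : Type*} [NormedField k] [IsUltrametricDist k]

lemma radius_pos : 0 < radius k := by
  unfold radius
  split_ifs with h
  · exact one_pos
  · have : 0 < ringChar (ResidueField k) := Nat.pos_of_ne_zero h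
    positivity

/-- An integer that does not vanish in the residue field has norm `1`. -/
lemma norm_natCast_eq_one {n : ℕ} (hn : (n : ResidueField k) ≠ 0) : ‖(n : k)‖ = 1 := by
  have h : IsUnit (n : (NormedField.valuation (K := k)).valuationSubring) := by
    rw [← IsLocalRing.residue_ne_zero_iff_isUnit, map_natCast]
    exact hn
  rw [(Valuation.valuationSubring.integers
    (NormedField.valuation (K := k))).isUnit_iff_valuation_eq_one] at h
  simpa [← NNReal.coe_inj] using h

/-- `R(k)^j ≤ |j + 1|`: the estimate that makes `R(k)` the right bound. -/
lemma radius_pow_le_norm_natCast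
    (hk : ∀ p : ℕ, p.Prime → CharP (ResidueField k) p → ‖(p : k)‖ = (p : ℝ)⁻¹) (j : ℕ) :
    radius k ^ j ≤ ‖((j + 1 : ℕ) : k)‖ := by
  have hchar : CharP (ResidueField k) (ringChar (ResidueField k)) := ringChar.charP _
  unfold radius
  generalize ringChar (ResidueField k) = p at hchar
  split_ifs with hp0
  · subst hp0
    rw [norm_natCast_eq_one, one_pow]
    rw [Ne, CharP.cast_eq_zero_iff (ResidueField k) 0]
    simp
  · have hp : p.Prime := (CharP.char_is_prime_or_zero (ResidueField k) p).resolve_right hp0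
    obtain ⟨v, u, hu, hj⟩ := Nat.exists_eq_pow_mul_and_not_dvd (Nat.succ_ne_zero j) p hp.ne_one
    have hu1 : ‖(u : k)‖ = 1 := norm_natCast_eq_one (by
      rwa [Ne, CharP.cast_eq_zero_iff (ResidueField k) p])
    rw [show j + 1 = p ^ v * u from hj]
    have hp1 : (1 : ℝ) < p := by exact_mod_cast hp.one_lt
    have hp0 : (0 : ℝ) < p := by linarith
    -- Bernoulli: `1 + v (p - 1) ≤ p ^ v ≤ j + 1`.
    have hv : (v : ℝ) * (p - 1) ≤ j := by
      have h1 : 1 + (v : ℝ) * (p - 1) ≤ (1 + (p - 1)) ^ v :=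
        one_add_mul_le_pow (by linarith) v
      have hu0 : u ≠ 0 := by rintro rfl; simp at hu
      have h2 : p ^ v ≤ j + 1 := 
        (Nat.le_mul_of_pos_right _ (Nat.pos_of_ne_zero hu0)).trans_eq hj.symm
      have h3 : (p : ℝ) ^ v ≤ j + 1 := by exact_mod_cast h2
      rw [add_sub_cancel] at h1
      linarith
    push_cast
    rw [norm_mul, norm_pow, hk p hp hchar, hu1, mul_one, inv_pow, ← Real.rpow_natCast,
      ← Real.rpow_natCast, ← Real.rpow_mul hp0.le, ← Real.rpow_neg hp0.le]
    apply Real.rpow_le_rpow_of_exponent_le hp1.le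
    rw [neg_mul, neg_le_neg_iff, one_div_mul_eq_div, le_div_iff₀ (by linarith)]
    exact hv

/-- The coefficients `(m + 1 choose i + 2) / (m + 1) = (m choose i + 1) / (i + 2)` of the equation
for `f^* - 1`. -/
lemma norm_choose_div_le [CharZero k]
    (hk : ∀ p : ℕ, p.Prime → CharP (ResidueField k) p → ‖(p : k)‖ = (p : ℝ)⁻¹) (m i : ℕ) :
    ‖((m + 1).choose (i + 2) : k) / (m + 1 : ℕ)‖ ≤ (radius k ^ (i + 1))⁻¹ := by
  have h : ((m + 1).choose (i + 2) : k) / (m + 1 : ℕ) =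
      (m.choose (i + 1) : k) / (i + 1 + 1 : ℕ) := by
    rw [div_eq_div_iff (by exact_mod_cast Nat.succ_ne_zero m)
      (by exact_mod_cast Nat.succ_ne_zero (i + 1))]
    have := Nat.add_one_mul_choose_eq m (i + 1)
    rw [mul_comm (m.choose (i + 1) : k)]
    exact_mod_cast this.symm
  rw [h, norm_div, div_eq_mul_inv]
  refine (mul_le_of_le_one_left (by positivity) (IsUltrametricDist.norm_natCast_le_one k _)).trans ?_
  exact inv_anti₀ (pow_pos radius_pos _) (radius_pow_le_norm_natCast hk (i + 1))

end Radius

/-! ### The quotient norm of an affinoid algebra -/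

section QuotientNorm

variable {k : Type*} [NormedField k] [IsUltrametricDist k] {n : ℕ} {r : Fin n → ℝ}

lemma tateNorm_nonneg (g : tateAlgebra k r) : 0 ≤ tateNorm g :=
  MvPowerSeries.gaussNorm_nonneg _ _ _ fun _ => norm_nonneg _

lemma tateNorm_add_le (hr : ∀ i, 0 < r i) (g h : tateAlgebra k r) :
    tateNorm (g + h) ≤ max (tateNorm g) (tateNorm h) :=
  MvPowerSeries.gaussNorm_add_le_max _ _ _ _ (fun i => (hr i).le) (fun _ => norm_nonneg _)
    (fun a b => IsUltrametricDist.norm_add_le_max a b)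
    (Tendsto.bddAbove_range_of_cofinite g.2) (Tendsto.bddAbove_range_of_cofinite h.2)

lemma tateNorm_smul (c : k) (g : tateAlgebra k r) : tateNorm (c • g) = ‖c‖ * tateNorm g := by
  simp only [tateNorm, MvPowerSeries.gaussNorm, Real.mul_iSup_of_nonneg (norm_nonneg c)]
  refine iSup_congr fun t => ?_
  rw [← mul_assoc, ← norm_mul]
  rfl

/-- The norm of an affinoid algebra is equivalent to an ultrametric norm `ν`, namely the quotient
norm of an admissible epimorphism from a Tate algebra. -/
lemma IsAffinoidAlgebra.exists_ultrametric {A : Type*} [NormedCommRing A] [NormedAlgebra k A]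
    [CompleteSpace A] (hA : IsAffinoidAlgebra k A) :
    ∃ (ν : A → ℝ) (C : ℝ), (∀ a, 0 ≤ ν a) ∧ IsNonarchimedean ν ∧
      (∀ (c : k) a, ν (c • a) ≤ ‖c‖ * ν a) ∧ (∀ a, ‖a‖ ≤ C * ν a) ∧ ∀ a, ν a ≤ C * ‖a‖ := by
  obtain ⟨n, r, hr, φ, C, hφ, hlift⟩ := hA
  have hbdd (a : A) : BddBelow (Set.range fun g : {g // φ g = a} => tateNorm g.1) :=
    ⟨0, by rintro _ ⟨g, rfl⟩; exact tateNorm_nonneg _⟩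
  have hne (a : A) : Nonempty {g // φ g = a} := let ⟨g, hg, _⟩ := hlift a; ⟨⟨g, hg⟩⟩
  refine ⟨fun a => ⨅ g : {g // φ g = a}, tateNorm g.1, |C|,
    fun a => Real.iInf_nonneg fun g => tateNorm_nonneg _, fun a b => ?_, fun c a => ?_,
    fun a => ?_, fun a => ?_⟩
  · refine le_of_forall_gt_imp_ge_of_dense fun t ht => ?_
    obtain ⟨g, hg⟩ := exists_lt_of_ciInf_lt ((le_max_left _ _).trans_lt ht)
    obtain ⟨h, hh⟩ := exists_lt_of_ciInf_lt ((le_max_right _ _).trans_lt ht)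
    refine (ciInf_le (hbdd _) ⟨g.1 + h.1, by rw [map_add, g.2, h.2]⟩).trans ?_
    exact (tateNorm_add_le hr _ _).trans (max_le hg.le hh.le)
  · rw [Real.mul_iInf_of_nonneg (norm_nonneg c)]
    refine le_ciInf fun g => ?_
    refine (ciInf_le (hbdd _) ⟨c • g.1, by rw [map_smul, g.2]⟩).trans ?_
    rw [tateNorm_smul]
  · rw [Real.mul_iInf_of_nonneg (abs_nonneg C)]
    refine le_ciInf fun g => ?_
    have hg := hφ g.1
    rw [g.2] at hg
    exact hg.trans (mul_le_mul_of_nonneg_right (le_abs_self C) (tateNorm_nonneg _))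
  · obtain ⟨g, hg, hgC⟩ := hlift a
    exact (ciInf_le (hbdd a) ⟨g, hg⟩).trans (hgC.trans (by gcongr; exact le_abs_self C))

end QuotientNorm

/-! ### Growth of the iterates of an operator -/

section Growth

variable {k A : Type*} [NormedField k] [NormedCommRing A] [NormedAlgebra k A]

/-- If `ρ(T) < R`, then `‖T^n a‖ / R^n → 0` for all `a`. -/
lemma tendsto_norm_pow_apply_div {T : Module.End k A} (hT : ∃ D : ℝ, ∀ a, ‖T a‖ ≤ D * ‖a‖)
    {R : ℝ} (hR : 0 < R) (h : operatorSpectralRadius T < R) (a : A) :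
    Tendsto (fun n : ℕ => ‖(T ^ n) a‖ / R ^ n) atTop (𝓝 0) := by
  obtain ⟨D, hD⟩ := hT
  obtain ⟨m, hm⟩ := exists_lt_of_ciInf_lt h
  have hm0 : 0 < (m : ℕ) := m.pos
  -- The set defining the operator norm is nonempty, so the infimum is not a junk value.
  have hDm (n : ℕ) (x : A) : ‖(T ^ n) x‖ ≤ |D| ^ n * ‖x‖ := by
    induction n with
    | zero => simp
    | succ n ih =>
      rw [pow_succ', Module.End.mul_apply, pow_succ', mul_assoc]
      exact (hD _).trans (mul_le_mul (le_abs_self D) ih (norm_nonneg _) (abs_nonneg D))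
  have hnonneg : 0 ≤ operatorNorm (T ^ (m : ℕ)) := Real.sInf_nonneg fun c hc => hc.1
  have hlt : operatorNorm (T ^ (m : ℕ)) < R ^ (m : ℕ) := by
    rw [one_div] at hm
    rw [← Real.rpow_natCast]
    exact (Real.rpow_inv_lt_iff_of_pos hnonneg hR.le (by exact_mod_cast hm0)).1 hm
  obtain ⟨c, ⟨hc0, hc⟩, hcR⟩ : ∃ c, (0 ≤ c ∧ ∀ x, ‖(T ^ (m : ℕ)) x‖ ≤ c * ‖x‖) ∧
      c < R ^ (m : ℕ) :=
    exists_lt_of_csInf_lt (by exact ⟨|D| ^ (m : ℕ), by positivity, hDm m⟩) hlt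
  have hiter (q : ℕ) (x : A) : ‖(T ^ ((m : ℕ) * q)) x‖ ≤ c ^ q * ‖x‖ := by
    induction q with
    | zero => simp
    | succ q ih =>
      rw [mul_add_one, add_comm, pow_add, Module.End.mul_apply, pow_succ', mul_assoc]
      exact (hc _).trans (by gcongr)
  have hRm : 0 < R ^ (m : ℕ) := by positivity
  have hq : Tendsto (fun n : ℕ => (c / R ^ (m : ℕ)) ^ (n / (m : ℕ))) atTop (𝓝 0) :=
    (tendsto_pow_atTop_nhds_zero_of_lt_one (by positivity) ((div_lt_one hRm).2 hcR)).comp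
      (Nat.tendsto_div_const_atTop hm0.ne')
  -- Write `n = m q + i` with `i < m` and bound the contribution of `i` uniformly.
  have hbound : Tendsto (fun n : ℕ => (c / R ^ (m : ℕ)) ^ (n / (m : ℕ)) *
      ∑ i ∈ Finset.range m, ‖(T ^ i) a‖ / R ^ i) atTop (𝓝 0) := by
    simpa using hq.mul_const _
  refine squeeze_zero (fun n => by positivity) (fun n => ?_) hbound
  calc ‖(T ^ n) a‖ / R ^ n
      = ‖(T ^ ((m : ℕ) * (n / m))) ((T ^ (n % m)) a)‖ / R ^ ((m : ℕ) * (n / m) + n % m) := by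
        rw [← Module.End.mul_apply, ← pow_add, Nat.div_add_mod]
    _ ≤ c ^ (n / (m : ℕ)) * ‖(T ^ (n % m)) a‖ / R ^ ((m : ℕ) * (n / m) + n % m) := by
        gcongr; exact hiter _ _
    _ = (c / R ^ (m : ℕ)) ^ (n / (m : ℕ)) * (‖(T ^ (n % m)) a‖ / R ^ (n % m)) := by
        rw [pow_add, pow_mul, div_pow]
        field_simp
    _ ≤ _ := by
        gcongr
        exact Finset.single_le_sum (f := fun i => ‖(T ^ i) a‖ / R ^ i)
          (fun i _ => by positivity) (Finset.mem_range.2 (Nat.mod_lt _ hm0))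

lemma nonpos_of_le_later {b : ℕ → ℝ} (hb : Tendsto b atTop (𝓝 0))
    (h : ∀ n, ∃ j, b n ≤ b (n + j + 1)) (n : ℕ) : b n ≤ 0 := by
  by_contra! hn
  obtain ⟨M, hM⟩ := eventually_atTop.1 (hb.eventually (gt_mem_nhds hn))
  have hlate (q : ℕ) : ∃ i, q ≤ i ∧ b n ≤ b i := by
    induction q with
    | zero => exact ⟨n, Nat.zero_le _, le_rfl⟩
    | succ q ih =>
      obtain ⟨i, hqi, hi⟩ := ih
      obtain ⟨j, hj⟩ := h i
      exact ⟨i + j + 1, by omega, hi.trans hj⟩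
  obtain ⟨i, hMi, hi⟩ := hlate M
  exact absurd hi (not_le.2 (hM i hMi))

end Growth

/-! ### Operators `1 + T` of finite order -/

/-- The binomial expansion of `(1 + T)^(m + 1) = 1`, solved for the linear term. -/
lemma eq_neg_sum_of_one_add_pow_eq_one {k V : Type*} [Field k] [CharZero k] [AddCommGroup V]
    [Module k V] {T : Module.End k V} {m : ℕ} (h : (1 + T) ^ (m + 1) = 1) :
    T = -∑ i ∈ Finset.range m,
      (((m + 1).choose (i + 2) : k) / (m + 1 : ℕ)) • T ^ (i + 2) := by
  have hm : ((m + 1 : ℕ) : k) ≠ 0 := by exact_mod_cast Nat.succ_ne_zero m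
  have hexp : ((m + 1 : ℕ) : k) • T +
      ∑ i ∈ Finset.range m, ((m + 1).choose (i + 2) : k) • T ^ (i + 2) = 0 := by
    rw [add_comm 1 T, (Commute.one_right T).add_pow, Finset.sum_range_succ',
      Finset.sum_range_succ'] at h
    simp only [one_pow, mul_one, Nat.choose_zero_right, pow_zero, Nat.cast_one, add_eq_right,
      zero_add, pow_one, Nat.choose_one_right] at h
    rw [← h, add_comm]
    simp only [Nat.cast_smul_eq_nsmul, nsmul_eq_mul, Nat.cast_comm]
  have h2 := congrArg (fun S => ((m + 1 : ℕ) : k)⁻¹ • S) hexp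
  simp only [smul_add, smul_smul, inv_mul_cancel₀ hm, one_smul, smul_zero, Finset.smul_sum] at h2
  rw [eq_neg_iff_add_eq_zero]
  simpa only [div_eq_inv_mul] using h2

/-- An operator `1 + T` of finite order on an affinoid algebra with `ρ(T) < R(k)` is trivial. -/
lemma eq_zero_of_one_add_pow_eq_one {k A : Type*} [NormedField k] [IsUltrametricDist k] [CharZero k]
    (hk : ∀ p : ℕ, p.Prime → CharP (ResidueField k) p → ‖(p : k)‖ = (p : ℝ)⁻¹)
    [NormedCommRing A] [NormedAlgebra k A] [CompleteSpace A] (hA : IsAffinoidAlgebra k A)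
    {T : Module.End k A} (hT : ∃ D : ℝ, ∀ a, ‖T a‖ ≤ D * ‖a‖)
    (hρ : operatorSpectralRadius T < radius k) {m : ℕ} (h : (1 + T) ^ (m + 1) = 1) : T = 0 := by
  obtain ⟨ν, C, hν0, hνadd, hνsmul, hνC, hCν⟩ := hA.exists_ultrametric
  have hR : 0 < radius k := radius_pos
  have hνneg (x : A) : ν (-x) ≤ ν x := by simpa using hνsmul (-1) x
  have hνzero : ν 0 = 0 := le_antisymm (by simpa using hνsmul 0 0) (hν0 0)
  ext a
  have hlim : Tendsto (fun n => ν ((T ^ (n + 1)) a) / radius k ^ (n + 1)) atTop (𝓝 0) := by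
    have hC := ((tendsto_add_atTop_iff_nat 1).2
      (tendsto_norm_pow_apply_div hT hR hρ a)).const_mul C
    rw [mul_zero] at hC
    refine squeeze_zero (fun n => div_nonneg (hν0 _) (by positivity)) (fun n => ?_) hC
    rw [← mul_div_assoc]
    gcongr
    exact hCν _
  have hle := nonpos_of_le_later hlim (fun n => ?_) 0
  · rw [zero_add, pow_one, pow_one, div_le_iff₀ hR, zero_mul] at hle
    have h0 : ν (T a) = 0 := le_antisymm hle (hν0 _)
    simpa [h0] using hνC (T a)
  · have hn : (T ^ (n + 1)) a = -∑ i ∈ Finset.range m,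
        (((m + 1).choose (i + 2) : k) / (m + 1 : ℕ)) • (T ^ (n + i + 1 + 1)) a := by
      have hlin := congrArg (fun S => (T ^ n) (S a)) (eq_neg_sum_of_one_add_pow_eq_one h)
      simp only [LinearMap.neg_apply, LinearMap.sum_apply, LinearMap.smul_apply, map_neg, map_sum,
        map_smul, ← Module.End.mul_apply, ← pow_add, ← pow_succ] at hlin
      exact hlin
    obtain ⟨i, -, hi⟩ := IsNonarchimedean.finset_image_add hνzero hν0 hνadd
      (fun i => (((m + 1).choose (i + 2) : k) / (m + 1 : ℕ)) • (T ^ (n + i + 1 + 1)) a)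
      (Finset.range m)
    refine ⟨i, ?_⟩
    have hle : ν ((T ^ (n + 1)) a) ≤ (radius k ^ (i + 1))⁻¹ * ν ((T ^ (n + i + 1 + 1)) a) := by
      rw [hn]
      refine (hνneg _).trans (hi.trans ((hνsmul _ _).trans ?_))
      exact mul_le_mul_of_nonneg_right (norm_choose_div_le hk m i) (hν0 _)
    rw [div_le_iff₀ (by positivity)]
    refine hle.trans_eq ?_
    rw [show n + i + 1 + 1 = (i + 1) + (n + 1) by ring, pow_add (radius k)]
    field_simp
    ring

/-! ### Endomorphisms of affinoid spaces -/

namespace Endomorphism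

variable {k A : Type*} [NormedField k] [NormedCommRing A] [NormedAlgebra k A]

lemma toLinearMap_comorphism_pow (f : Endomorphism k A) (n : ℕ) :
    (f ^ n).comorphism.toLinearMap = f.comorphism.toLinearMap ^ n := by
  induction n with
  | zero => rfl
  | succ n ih =>
    rw [pow_succ, pow_succ', ← ih]
    rfl

/-- The map on points is determined by the comorphism. -/
lemma comorphism_injective {f g : Endomorphism k A} (h : f.comorphism = g.comorphism) : f = g := by
  refine Endomorphism.ext (funext fun x => Spectrum.ext (DFunLike.ext _ _ fun a => ?_)) h
  rw [f.seminorm_toFun, g.seminorm_toFun, h]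

lemma difference_bounded (f : Endomorphism k A) : ∃ D : ℝ, ∀ a, ‖f.difference a‖ ≤ D * ‖a‖ := by
  obtain ⟨D, hD⟩ := f.bounded
  refine ⟨D + 1, fun a => (norm_sub_le _ _).trans ?_⟩
  rw [add_mul, one_mul]
  exact add_le_add (hD a) le_rfl

end Endomorphism

end Affinoid

theorem corollary8 {k A : Type*} [NormedField k] [IsUltrametricDist k] [CompleteSpace k]
    [CharZero k]
    (hk : ∀ p : ℕ, p.Prime → CharP (Affinoid.ResidueField k) p → ‖(p : k)‖ = (p : ℝ)⁻¹)
    [NormedCommRing A] [NormedAlgebra k A] [CompleteSpace A]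
    (hA : Affinoid.IsAffinoidAlgebra k A)
    (f : Affinoid.Endomorphism k A)
    (hf : Affinoid.operatorSpectralRadius f.difference < Affinoid.radius k)
    (l : ℕ) (hl : 1 ≤ l) (hfl : f ^ l = 1) :
    f = 1 := by
  obtain ⟨m, rfl⟩ := Nat.exists_eq_add_of_le' hl
  have hadd : 1 + f.difference = f.comorphism.toLinearMap := add_sub_cancel _ _
  have hpow : (1 + f.difference) ^ (m + 1) = 1 := by
    rw [hadd, ← f.toLinearMap_comorphism_pow, hfl]
    rfl
  have h0 := Affinoid.eq_zero_of_one_add_pow_eq_one hk hA f.difference_bounded hf hpow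
  rw [h0, add_zero] at hadd
  exact Affinoid.Endomorphism.comorphism_injective (AlgHom.toLinearMap_injective hadd.symm)
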